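/- Theorem 1 (minimax upper bound). Let $\|\cdot\|_F$, $\|\cdot\|_*$ and $\|\cdot\|_{1,2}$ denote the Frobenius norm, the nuclear norm, and the sum of the Euclidean norms of the rows of a matrix. A matrix $\Psi\in\mathbb R^{m\times p_1}$ is a restricted isometry with constant $\delta\in[0,1]$ over row-wise $s$-sparse matrices if $(1-\delta)\|X\|_F^2\le\|\Psi X\|_F^2\le(1+\delta)\|X\|_F^2$ for all $X\in\mathbb R^{p_1\times p_2}$ with at most $s$ nonzero rows; a linear map $\mathcal W:\mathbb R^{m\times p_2}\to\mathbb R^n$ is a restricted isometry with constant $\delta\in[0,1]$ over rank-$s$ matrices if $(1-\delta)\|B\|_F^2\le\|\mathcal W(B)\|_2^2\le(1+\delta)\|B\|_F^2$ for all $B\in\mathbb R^{m\times p_2}$ of rank at most $s$. There is an absolute constant $\delta_0>0$ such that for every $c>0$ there are positive constants $c_1,c_2,C,c_0$, depending only on $c$, with the following property. Let $k,r\ge 1$, let $n\le c\,r(m\vee p_2)$, let $\sigma\ge 0$, and let $\Psi$ and $\mathcal W$ be restricted isometries with constants at most $\delta_0$ over row-wise $2k$-sparse matrices and over rank-$4r$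 matrices, respectively. For $z\sim\mathsf N(0,\sigma^2 I_n)$ and $y=\mathcal W(\Psi X^\star)+z$ consider the two-stage estimator $$\widehat B\in\operatorname*{argmin}_B\|B\|_*\ \text{ subject to }\ \|\mathcal W(B)-y\|_2\le\sigma\sqrt{n+c_1r(m\vee p_2)},$$ $$\widehat X\in\operatorname*{argmin}_X\|X\|_{1,2}\ \text{ subject to }\ \|\Psi X-\widehat B\|_F\le c_2\,\sigma\sqrt{r(m\vee p_2)}.$$ Then, with probability at least $1-4e^{-c_0r(m\vee p_2)}$ over $z$, the following holds simultaneously for all $X^\star\in\mathbb R^{p_1\times p_2}$ of rank at most $r$ with at most $k$ nonzero rows: the first program has a minimizer, for each of its minimizers $\widehat B$ the second program has a minimizer, and all minimizers $\widehat X$ obtained in this way satisfy $$\|\widehat X-X^\star\|_F\le C\sigma\sqrt{r(m\vee p_2)}.$$ -/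

import Mathlib

open MeasureTheory ProbabilityTheory
open scoped Matrix.Norms.Frobenius

/-- The number of nonzero rows of a matrix. -/
noncomputable def numNonzeroRows {a b : ℕ} (X : Matrix (Fin a) (Fin b) ℝ) : ℕ :=
  {i : Fin a | X.row i ≠ 0}.ncard

/-- The nuclear norm: the sum of the singular values. A matrix with `b` columns has at most `b`
nonzero singular values, and Mathlib's sequence of singular values vanishes from index `b` on. -/
noncomputable def nuclearNorm {a b : ℕ} (X : Matrix (Fin a) (Fin b) ℝ) : ℝ :=
  ∑ i ∈ Finset.range b, (Matrix.toEuclideanLin X).singularValues i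

/-- The `ℓ_{1,2}` norm: the sum of the Euclidean norms of the rows. -/
noncomputable def rowSumNorm {a b : ℕ} (X : Matrix (Fin a) (Fin b) ℝ) : ℝ :=
  ∑ i, ‖WithLp.toLp 2 (X.row i)‖

/-- `Ψ` is a restricted isometry, with constant `δ ∈ [0, 1]`, over the matrices with `b` columns
and at most `s` nonzero rows. The norm of a matrix is the Frobenius norm. -/
def IsRowSparseRIP {m a : ℕ} (b : ℕ) (Ψ : Matrix (Fin m) (Fin a) ℝ) (s : ℕ) (δ : ℝ) : Prop :=
  0 ≤ δ ∧ δ ≤ 1 ∧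
    ∀ X : Matrix (Fin a) (Fin b) ℝ, numNonzeroRows X ≤ s →
      (1 - δ) * ‖X‖ ^ 2 ≤ ‖Ψ * X‖ ^ 2 ∧ ‖Ψ * X‖ ^ 2 ≤ (1 + δ) * ‖X‖ ^ 2

/-- `W` is a restricted isometry, with constant `δ ∈ [0, 1]`, over the matrices of rank at most
`s`. -/
def IsLowRankRIP {m b n : ℕ} (W : Matrix (Fin m) (Fin b) ℝ →ₗ[ℝ] EuclideanSpace ℝ (Fin n))
    (s : ℕ) (δ : ℝ) : Prop :=
  0 ≤ δ ∧ δ ≤ 1 ∧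
    ∀ B : Matrix (Fin m) (Fin b) ℝ, B.rank ≤ s →
      (1 - δ) * ‖B‖ ^ 2 ≤ ‖W B‖ ^ 2 ∧ ‖W B‖ ^ 2 ≤ (1 + δ) * ‖B‖ ^ 2

/-- The set of minimizers of `f` over the feasible set `S`. -/
def argminOver {α : Type*} (f : α → ℝ) (S : Set α) : Set α :=
  {x | x ∈ S ∧ IsMinOn f S x}

/-- The possible outputs `B̂` of the first (nuclear norm) stage. -/
def lowRankStage {m b n : ℕ} (W : Matrix (Fin m) (Fin b) ℝ →ₗ[ℝ] EuclideanSpace ℝ (Fin n))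
    (y : EuclideanSpace ℝ (Fin n)) (σ c₁ : ℝ) (r : ℕ) : Set (Matrix (Fin m) (Fin b) ℝ) :=
  argminOver nuclearNorm
    {B | ‖W B - y‖ ≤ σ * √((n : ℝ) + c₁ * ((r : ℝ) * max (m : ℝ) (b : ℝ)))}

/-- The possible outputs `X̂` of the second (`ℓ_{1,2}` norm) stage, run on `Bhat`. -/
def sparseStage {m a b : ℕ} (Ψ : Matrix (Fin m) (Fin a) ℝ) (Bhat : Matrix (Fin m) (Fin b) ℝ)
    (σ c₂ : ℝ) (r : ℕ) : Set (Matrix (Fin a) (Fin b) ℝ) :=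
  argminOver rowSumNorm
    {X | ‖Ψ * X - Bhat‖ ≤ c₂ * σ * √((r : ℝ) * max (m : ℝ) (b : ℝ))}

/-- The Gaussian law `N(0, σ² I)` on `ℝⁿ`. -/
noncomputable def noiseLaw (n : ℕ) (σ : ℝ) : Measure (EuclideanSpace ℝ (Fin n)) :=
  multivariateGaussian 0 (σ ^ 2 • (1 : Matrix (Fin n) (Fin n) ℝ))

/-! Randomness enters only through the event `‖z‖ ≤ σ√(n + c₁u)` with `u = r(m ∨ p₂)`, whose failure
has probability at most `4e^{-u}` by a chi-square Chernoff bound (`noiseLaw_feasible`). The event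
does not involve `X⋆`, so the rest is deterministic and uniform in `X⋆`.

Both stages run on one scheme. On the event the true object is feasible, so a minimizer has no
larger norm, and this forces the error `H` into a cone: `H` is a simple part `h₀` plus orthogonal
atoms `w i` with `∑ ‖w i‖ ≤ √s ‖h₀‖`. Grouping the atoms by decreasing norm into blocks of `s` turns
restricted isometry into `‖H‖ ≤ 6‖A H‖` (`norm_le_of_nearIsometryAt`), and `‖A H‖` is at most the
sum of two feasibility residuals. The atoms are singular components in `IsLowRankRIP.norm_le` and
single rows in `IsRowSparseRIP.norm_le`. The first stage's error bound is the second stage's radius.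

The cone condition for the nuclear norm rests on duality: partial isometries bound it from below
(`trace_le_nuclearNorm`) and the polar factor attains it (`exists_polar_factor`). -/

/-- The restricted isometry estimate for a single vector. -/
def NearIsometryAt {E F : Type*} [NormedAddCommGroup E] [InnerProductSpace ℝ E]
    [NormedAddCommGroup F] [InnerProductSpace ℝ F] (A : E →ₗ[ℝ] F) (δ : ℝ) (x : E) : Prop :=
  (1 - δ) * ‖x‖ ^ 2 ≤ ‖A x‖ ^ 2 ∧ ‖A x‖ ^ 2 ≤ (1 + δ) * ‖x‖ ^ 2

/-! ### Restricted isometry on a cone, in inner product spaces -/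

section Stability

variable {E F : Type*} [NormedAddCommGroup E] [InnerProductSpace ℝ E]
    [NormedAddCommGroup F] [InnerProductSpace ℝ F]

/-- Polarization: by orthogonality `‖y‖x + ‖x‖y` and `‖y‖x - ‖x‖y` both have squared norm
`2‖x‖²‖y‖²`, while their images' squared norms differ by `4‖x‖‖y‖⟨Ax, Ay⟩`. -/
theorem abs_inner_le_of_nearIsometryAt (A : E →ₗ[ℝ] F) {δ : ℝ} {x y : E}
    (hxy : inner ℝ x y = 0) (h : ∀ a b : ℝ, NearIsometryAt A δ (a • x + b • y)) :
    |inner ℝ (A x) (A y)| ≤ δ * (‖x‖ * ‖y‖) := by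
  rcases eq_or_ne x 0 with rfl | hx
  · simp
  rcases eq_or_ne y 0 with rfl | hy
  · simp
  have hx' : 0 < ‖x‖ := norm_pos_iff.2 hx
  have hy' : 0 < ‖y‖ := norm_pos_iff.2 hy
  have hn : ∀ a b : ℝ, ‖a • x + b • y‖ ^ 2 = a ^ 2 * ‖x‖ ^ 2 + b ^ 2 * ‖y‖ ^ 2 := by
    intro a b
    rw [norm_add_sq_real, inner_smul_left, inner_smul_right, hxy, norm_smul, norm_smul,
      mul_pow, mul_pow]
    simp
  have hA : ∀ a b : ℝ, ‖A (a • x + b • y)‖ ^ 2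
      = a ^ 2 * ‖A x‖ ^ 2 + 2 * (a * b * inner ℝ (A x) (A y)) + b ^ 2 * ‖A y‖ ^ 2 := by
    intro a b
    rw [map_add, map_smul, map_smul, norm_add_sq_real, inner_smul_left, inner_smul_right,
      norm_smul, norm_smul, mul_pow, mul_pow]
    simp
    ring
  have h1 := h ‖y‖ ‖x‖
  have h2 := h ‖y‖ (-‖x‖)
  unfold NearIsometryAt at h1 h2
  rw [hn, hA] at h1 h2
  have hp : 0 < ‖x‖ * ‖y‖ := mul_pos hx' hy'
  rw [abs_le]
  constructor
  · refine le_of_mul_le_mul_left ?_ hp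
    nlinarith [h1.1, h1.2, h2.1, h2.2]
  · refine le_of_mul_le_mul_left ?_ hp
    nlinarith [h1.1, h1.2, h2.1, h2.2]

theorem norm_sum_sq_of_orthogonal {ι : Type*} [DecidableEq ι] (I : Finset ι) (w : ι → E)
    (hw : ∀ i j, i ≠ j → inner ℝ (w i) (w j) = 0) :
    ‖∑ i ∈ I, w i‖ ^ 2 = ∑ i ∈ I, ‖w i‖ ^ 2 := by
  rw [← real_inner_self_eq_norm_sq, sum_inner]
  refine Finset.sum_congr rfl fun i hi => ?_
  rw [inner_sum, Finset.sum_eq_single i (fun j _ hj => hw i j hj.symm) (fun h => absurd hi h),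
    real_inner_self_eq_norm_sq]

theorem sum_blocks {M : Type*} [AddCommMonoid M] (v : ℕ → M) (s L : ℕ) :
    ∑ j ∈ Finset.range L, ∑ i ∈ Finset.Ico (j * s) ((j + 1) * s), v i
      = ∑ i ∈ Finset.range (L * s), v i := by
  induction L with
  | zero => simp
  | succ L ih =>
    rw [Finset.sum_range_succ, ih, Finset.range_eq_Ico, Finset.sum_Ico_consecutive _ (by simp)
      (Nat.mul_le_mul_right _ (Nat.le_succ L)), Finset.range_eq_Ico]

/-- Norms of consecutive blocks of an orthogonal sequence with decreasing norms. -/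
theorem sum_norm_blocks_le (v : ℕ → E) (hv : ∀ i j, i ≠ j → inner ℝ (v i) (v j) = 0)
    (hmono : Antitone fun i => ‖v i‖) {s : ℕ} (hs : 1 ≤ s) (L : ℕ) :
    √s * ∑ j ∈ Finset.range L, ‖∑ i ∈ Finset.Ico ((j + 1) * s) ((j + 2) * s), v i‖
      ≤ ∑ i ∈ Finset.range (L * s), ‖v i‖ := by
  rw [← sum_blocks, Finset.mul_sum]
  refine Finset.sum_le_sum fun j _ => ?_
  have h1 : ‖∑ i ∈ Finset.Ico ((j + 1) * s) ((j + 2) * s), v i‖ ^ 2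
      ≤ s * ‖v ((j + 1) * s)‖ ^ 2 := by
    rw [norm_sum_sq_of_orthogonal _ _ hv]
    refine (Finset.sum_le_card_nsmul _ _ (‖v ((j + 1) * s)‖ ^ 2) fun i hi => ?_).trans ?_
    · exact pow_le_pow_left₀ (norm_nonneg _) (hmono (Finset.mem_Ico.1 hi).1) 2
    · rw [Nat.card_Ico, nsmul_eq_mul, ← Nat.sub_mul]
      simp
  have h2 : s * ‖v ((j + 1) * s)‖ ≤ ∑ i ∈ Finset.Ico (j * s) ((j + 1) * s), ‖v i‖ := by
    have := Finset.card_nsmul_le_sum (Finset.Ico (j * s) ((j + 1) * s)) (fun i => ‖v i‖)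
      ‖v ((j + 1) * s)‖ fun i hi => hmono (Finset.mem_Ico.1 hi).2.le
    rw [Nat.card_Ico, nsmul_eq_mul, ← Nat.sub_mul] at this
    simpa using this
  refine le_trans ?_ h2
  have hs0 : (0 : ℝ) ≤ s := Nat.cast_nonneg s
  refine abs_le_of_sq_le_sq' ?_ (by positivity) |>.2
  rw [mul_pow, Real.sq_sqrt hs0]
  nlinarith [mul_le_mul_of_nonneg_left h1 hs0]

theorem sum_range_eq_of_forall_ge {M : Type*} [AddCommMonoid M] (f : ℕ → M) {N K : ℕ}
    (hf : ∀ i, N ≤ i → f i = 0) (hK : N ≤ K) :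
    ∑ i ∈ Finset.range K, f i = ∑ i ∈ Finset.range N, f i := by
  refine (Finset.sum_subset (Finset.range_mono hK) fun i _ hi => hf i ?_).symm
  simpa using hi

/-- Let `x` be `h₀` plus the leading block and `t` the remaining blocks. Monotonicity and the cone
condition bound the sum of the norms of the blocks in `t` by `‖h₀‖ ≤ ‖x‖`, so it suffices to control
`x`. The images of `x` and `t` are nearly orthogonal; splitting `x` into its two pieces means that
only pairs of pieces are ever tested. -/
theorem norm_le_of_nearIsometryAt_sequence (A : E →ₗ[ℝ] F) {δ : ℝ} (hδ0 : 0 ≤ δ)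
    (hδ : δ ≤ 1 / 10) {s : ℕ} (hs : 1 ≤ s) (h₀ : E) (v : ℕ → E) (N : ℕ)
    (hN : ∀ i, N ≤ i → v i = 0)
    (hv : ∀ i j, i ≠ j → inner ℝ (v i) (v j) = 0) (hv0 : ∀ i, inner ℝ h₀ (v i) = 0)
    (hmono : Antitone fun i => ‖v i‖)
    (hcone : ∑ i ∈ Finset.range N, ‖v i‖ ≤ √s * ‖h₀‖)
    (hR0 : ∀ I : Finset ℕ, I.card ≤ s → ∀ a b : ℝ,
      NearIsometryAt A δ (a • h₀ + b • ∑ i ∈ I, v i))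
    (hR1 : ∀ I J : Finset ℕ, I.card ≤ s → J.card ≤ s → ∀ a b : ℝ,
      NearIsometryAt A δ (a • ∑ i ∈ I, v i + b • ∑ i ∈ J, v i)) :
    ‖h₀ + ∑ i ∈ Finset.range N, v i‖ ≤ 6 * ‖A (h₀ + ∑ i ∈ Finset.range N, v i)‖ := by
  have hKN : ∀ K, N ≤ K → N ≤ K * s := fun K hK => hK.trans (Nat.le_mul_of_pos_right K hs)
  let B : ℕ → E := fun j => ∑ i ∈ Finset.Ico (j * s) ((j + 1) * s), v i
  have hcard : ∀ j, (Finset.Ico (j * s) ((j + 1) * s)).card ≤ s := by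
    intro j
    rw [Nat.card_Ico, ← Nat.sub_mul]
    simp
  have hdecomp : ∑ i ∈ Finset.range N, v i = B 0 + ∑ j ∈ Finset.range N, B (j + 1) := by
    -- Since `s ≥ 1`, `N + 1` blocks cover all of `range N`; the surplus terms are zero.
    rw [← sum_range_eq_of_forall_ge v hN (K := (N + 1) * s) (hKN _ (Nat.le_succ N)), ← sum_blocks, Finset.sum_range_succ',
      add_comm]
  set T := ∑ j ∈ Finset.range N, ‖B (j + 1)‖ with hT
  have hT0 : 0 ≤ T := Finset.sum_nonneg fun _ _ => norm_nonneg _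
  have hsq : 0 < √(s : ℝ) := Real.sqrt_pos.2 (by exact_mod_cast hs)
  have hTle : T ≤ ‖h₀‖ := by
    refine le_of_mul_le_mul_left ?_ hsq
    refine (sum_norm_blocks_le v hv hmono hs N).trans ?_
    rw [sum_range_eq_of_forall_ge (fun i => ‖v i‖) (fun i hi => by simp [hN i hi]) (hKN N le_rfl)]
    exact hcone
  have hB0 : inner ℝ h₀ (B 0) = 0 := by
    rw [inner_sum]
    exact Finset.sum_eq_zero fun i _ => hv0 i
  have hBj : ∀ j, inner ℝ h₀ (B (j + 1)) = 0 := fun j => by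
    rw [inner_sum]
    exact Finset.sum_eq_zero fun i _ => hv0 i
  have hBB : ∀ j, inner ℝ (B 0) (B (j + 1)) = 0 := fun j => by
    rw [sum_inner]
    refine Finset.sum_eq_zero fun i hi => ?_
    rw [inner_sum]
    refine Finset.sum_eq_zero fun i' hi' => hv i i' ?_
    rw [Finset.mem_Ico] at hi hi'
    have : (0 + 1) * s ≤ (j + 1) * s := Nat.mul_le_mul_right _ (by omega)
    omega
  set x := h₀ + B 0 with hx
  have hxsq : ‖x‖ ^ 2 = ‖h₀‖ ^ 2 + ‖B 0‖ ^ 2 := by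
    rw [hx, norm_add_sq_real, hB0]
    ring
  have hh0x : ‖h₀‖ ≤ ‖x‖ := by
    refine abs_le_of_sq_le_sq' ?_ (norm_nonneg _) |>.2
    nlinarith [sq_nonneg ‖B 0‖]
  have hB0x : ‖B 0‖ ≤ ‖x‖ := by
    refine abs_le_of_sq_le_sq' ?_ (norm_nonneg _) |>.2
    nlinarith [sq_nonneg ‖h₀‖]
  have htot : h₀ + ∑ i ∈ Finset.range N, v i = x + ∑ j ∈ Finset.range N, B (j + 1) := by
    rw [hdecomp, hx, add_assoc]
  rw [htot]
  set t := ∑ j ∈ Finset.range N, B (j + 1) with ht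
  have htT : ‖t‖ ≤ T := norm_sum_le _ _
  have hcross : |inner ℝ (A x) (A t)| ≤ δ * (‖h₀‖ + ‖B 0‖) * T := by
    rw [ht, map_sum, inner_sum, hT, Finset.mul_sum]
    refine (Finset.abs_sum_le_sum_abs _ _).trans (Finset.sum_le_sum fun j _ => ?_)
    rw [hx, map_add, inner_add_left]
    refine (abs_add_le _ _).trans ?_
    have e1 := abs_inner_le_of_nearIsometryAt A (hBj j) fun a b => hR0 _ (hcard (j + 1)) a b
    have e2 := abs_inner_le_of_nearIsometryAt A (hBB j)
      fun a b => hR1 _ _ (hcard 0) (hcard (j + 1)) a b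
    linarith
  have hxR : NearIsometryAt A δ x := by
    have := hR0 _ (hcard 0) 1 1
    rwa [one_smul, one_smul] at this
  have hexp : ‖A x‖ ^ 2 = inner ℝ (A x) (A (x + t)) - inner ℝ (A x) (A t) := by
    rw [map_add A x t, inner_add_right, real_inner_self_eq_norm_sq]
    ring
  have hcs := real_inner_le_norm (A x) (A (x + t))
  have hAx : ‖A x‖ ≤ 2 * ‖x‖ := by
    refine abs_le_of_sq_le_sq' ?_ (by positivity) |>.2
    nlinarith [hxR.2, sq_nonneg ‖x‖]
  have hcross' : |inner ℝ (A x) (A t)| ≤ 2 / 10 * (‖x‖ * ‖x‖) := by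
    refine hcross.trans ?_
    have h1 : (‖h₀‖ + ‖B 0‖) * T ≤ (2 * ‖x‖) * ‖x‖ :=
      mul_le_mul (by linarith) (hTle.trans hh0x) hT0 (by positivity)
    have h2 : 0 ≤ (‖h₀‖ + ‖B 0‖) * T := by positivity
    nlinarith
  have hlow : 9 / 10 * ‖x‖ ^ 2 ≤ ‖A x‖ ^ 2 := by nlinarith [hxR.1, sq_nonneg ‖x‖]
  -- `9/10` from the lower isometry bound at `x`, minus the cross term `2δ ≤ 2/10`.
  have hmain : 7 / 10 * (‖x‖ * ‖x‖) ≤ 2 * ‖A (x + t)‖ * ‖x‖ := by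
    have h3 : ‖A x‖ * ‖A (x + t)‖ ≤ 2 * ‖x‖ * ‖A (x + t)‖ :=
      mul_le_mul_of_nonneg_right hAx (norm_nonneg _)
    nlinarith [neg_le_of_abs_le hcross']
  have hx6 : ‖x‖ ≤ 3 * ‖A (x + t)‖ := by
    rcases (norm_nonneg x).eq_or_lt with h | h
    · rw [← h]; positivity
    · have : 7 / 10 * ‖x‖ ≤ 2 * ‖A (x + t)‖ := by
        refine le_of_mul_le_mul_right ?_ h
        linarith
      have := norm_nonneg (A (x + t))
      linarith
  calc ‖x + t‖ ≤ ‖x‖ + ‖t‖ := norm_add_le _ _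
    _ ≤ 6 * ‖A (x + t)‖ := by linarith

/-- Sorting the family by decreasing norm and padding it with zeros gives a sequence; an index set
of the sequence corresponds to a no larger index set of the family. -/
theorem norm_le_of_nearIsometryAt {ι : Type*} [Fintype ι] (A : E →ₗ[ℝ] F) {δ : ℝ}
    (hδ0 : 0 ≤ δ) (hδ : δ ≤ 1 / 10) {s : ℕ} (hs : 1 ≤ s) (h₀ : E) (w : ι → E)
    (hw : ∀ i j, i ≠ j → inner ℝ (w i) (w j) = 0) (hw0 : ∀ i, inner ℝ h₀ (w i) = 0)
    (hcone : ∑ i, ‖w i‖ ≤ √s * ‖h₀‖)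
    (hR0 : ∀ I : Finset ι, I.card ≤ s → ∀ a b : ℝ,
      NearIsometryAt A δ (a • h₀ + b • ∑ i ∈ I, w i))
    (hR1 : ∀ I J : Finset ι, I.card ≤ s → J.card ≤ s → ∀ a b : ℝ,
      NearIsometryAt A δ (a • ∑ i ∈ I, w i + b • ∑ i ∈ J, w i)) :
    ‖h₀ + ∑ i, w i‖ ≤ 6 * ‖A (h₀ + ∑ i, w i)‖ := by
  classical
  let N := Fintype.card ι
  let f := (Fintype.equivFin ι).symm
  let e : Fin N ≃ ι := (Tuple.sort fun i => -‖w (f i)‖).trans f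
  have hmono : Antitone fun i => ‖w (e i)‖ := by
    intro i j hij
    have := Tuple.monotone_sort (fun i => -‖w (f i)‖) hij
    exact neg_le_neg_iff.1 this
  let v : ℕ → E := fun i => if h : i < N then w (e ⟨i, h⟩) else 0
  have hvlt : ∀ i (h : i < N), v i = w (e ⟨i, h⟩) := fun i h => dif_pos h
  have hvge : ∀ i, N ≤ i → v i = 0 := fun i h => dif_neg (not_lt.2 h)
  have hid : ∑ i ∈ Finset.range N, v i = ∑ i, w i := by
    rw [Finset.sum_range, ← e.sum_comp]
    exact Finset.sum_congr rfl fun i _ => by rw [hvlt i i.2]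
  have hnorm : ∑ i ∈ Finset.range N, ‖v i‖ = ∑ i, ‖w i‖ := by
    rw [Finset.sum_range, ← e.sum_comp]
    exact Finset.sum_congr rfl fun i _ => by rw [hvlt i i.2]
  have hblock : ∀ I : Finset ℕ, ∃ J : Finset ι, J.card ≤ I.card ∧
      ∑ i ∈ I, v i = ∑ i ∈ J, w i := by
    intro I
    refine ⟨Finset.univ.filter fun i => ((e.symm i : Fin N) : ℕ) ∈ I, ?_, ?_⟩
    · refine Finset.card_le_card_of_injOn (fun i => ((e.symm i : Fin N) : ℕ)) ?_ ?_
      · intro i hi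
        simpa using hi
      · intro i _ j _ hij
        exact e.symm.injective (Fin.ext hij)
    · symm
      refine Finset.sum_of_injOn (fun i => ((e.symm i : Fin N) : ℕ)) ?_ ?_ ?_ ?_
      · intro i _ j _ hij
        exact e.symm.injective (Fin.ext hij)
      · intro i hi
        simpa using hi
      · intro i hi hni
        refine hvge i ?_
        by_contra hlt
        refine hni ⟨e ⟨i, not_le.1 hlt⟩, ?_, ?_⟩ <;> simp [hi]
      · intro i _
        rw [hvlt _ (e.symm i).2]
        simp
  rw [← hid]
  refine norm_le_of_nearIsometryAt_sequence A hδ0 hδ hs h₀ v N hvge ?_ ?_ ?_ ?_ ?_ ?_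
  · intro i j hij
    by_cases hi : i < N
    · by_cases hj : j < N
      · rw [hvlt i hi, hvlt j hj]
        refine hw _ _ fun h => hij ?_
        simpa using e.injective h
      · rw [hvge j (not_lt.1 hj), inner_zero_right]
    · rw [hvge i (not_lt.1 hi), inner_zero_left]
  · intro i
    by_cases hi : i < N
    · rw [hvlt i hi]
      exact hw0 _
    · rw [hvge i (not_lt.1 hi), inner_zero_right]
  · intro i j hij
    change ‖v j‖ ≤ ‖v i‖
    by_cases hj : j < N
    · rw [hvlt j hj, hvlt i (hij.trans_lt hj)]
      exact hmono (by exact hij)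
    · rw [hvge j (not_lt.1 hj), norm_zero]
      exact norm_nonneg _
  · rw [hnorm]
    exact hcone
  · intro I hI a b
    obtain ⟨J, hJ, h⟩ := hblock I
    rw [h]
    exact hR0 J (hJ.trans hI) a b
  · intro I I' hI hI' a b
    obtain ⟨J, hJ, h⟩ := hblock I
    obtain ⟨J', hJ', h'⟩ := hblock I'
    rw [h, h']
    exact hR1 J J' (hJ.trans hI) (hJ'.trans hI') a b

end Stability

/-! ### Existence of minimizers -/

/-- A continuous function dominating the norm is coercive. -/
theorem argminOver_nonempty {E : Type*} [NormedAddCommGroup E] [NormedSpace ℝ E]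
    [FiniteDimensional ℝ E] {f : E → ℝ} (hf : Continuous f) (hle : ∀ x, ‖x‖ ≤ f x)
    {S : Set E} (hS : IsClosed S) (hne : S.Nonempty) : (argminOver f S).Nonempty := by
  have : ProperSpace E := FiniteDimensional.proper ℝ E
  obtain ⟨x₀, hx₀⟩ := hne
  have ht : Filter.Tendsto f (Filter.cocompact E) Filter.atTop :=
    Filter.tendsto_atTop_mono hle (tendsto_norm_cocompact_atTop)
  obtain ⟨x, hx, hmin⟩ := hf.continuousOn.exists_isMinOn' hS hx₀
    ((ht.eventually_ge_atTop (f x₀)).filter_mono inf_le_left)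
  exact ⟨x, hx, hmin⟩

/-! ### The Frobenius inner product -/

section Frobenius

variable {a b : ℕ}

theorem frobenius_norm_sq (X : Matrix (Fin a) (Fin b) ℝ) : ‖X‖ ^ 2 = (X.transpose * X).trace := by
  rw [Matrix.frobenius_norm_def, ← Real.sqrt_eq_rpow, Real.sq_sqrt (by positivity),
    Finset.sum_comm, Matrix.trace]
  refine Finset.sum_congr rfl fun j _ => ?_
  rw [Matrix.diag_apply, Matrix.mul_apply]
  refine Finset.sum_congr rfl fun i _ => ?_
  simp [Matrix.transpose_apply, sq]

/-- The trace inner product, which induces the Frobenius norm. -/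
noncomputable instance frobeniusInnerProductSpace :
    InnerProductSpace ℝ (Matrix (Fin a) (Fin b) ℝ) where
  __ := (inferInstance : NormedSpace ℝ (Matrix (Fin a) (Fin b) ℝ))
  inner A B := (A.transpose * B).trace
  norm_sq_eq_re_inner X := frobenius_norm_sq X
  conj_inner_symm A B := by
    simp only [conj_trivial]
    rw [← Matrix.trace_transpose, Matrix.transpose_mul, Matrix.transpose_transpose]
  add_left A B C := by simp [Matrix.add_mul]
  smul_left A B t := by simp

theorem frobenius_inner_eq (A B : Matrix (Fin a) (Fin b) ℝ) :
    inner ℝ A B = (A.transpose * B).trace := rfl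

end Frobenius

open Matrix

/-! ### Singular vectors and nuclear norm duality -/

section Nuclear

variable {a b : ℕ}

/-- An orthogonal matrix of right singular vectors. -/
theorem exists_right_singular_basis (X : Matrix (Fin a) (Fin b) ℝ) :
    ∃ (V : Matrix (Fin b) (Fin b) ℝ) (d : Fin b → ℝ), (∀ i, 0 ≤ d i) ∧ Vᵀ * V = 1 ∧ V * Vᵀ = 1 ∧
      Vᵀ * (Xᵀ * X) * V = diagonal (fun i => d i ^ 2) ∧ nuclearNorm X = ∑ i, d i := by
  set T := Matrix.toEuclideanLin X with hT
  have hn : Module.finrank ℝ (EuclideanSpace ℝ (Fin b)) = b := by simp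
  obtain ⟨e, he⟩ : ∃ e : OrthonormalBasis (Fin b) ℝ (EuclideanSpace ℝ (Fin b)), ∀ j,
      (LinearMap.adjoint T ∘ₗ T) (e j) = (T.singularValues j) ^ 2 • e j := by
    refine ⟨T.isSymmetric_adjoint_comp_self.eigenvectorBasis hn, fun j => ?_⟩
    rw [LinearMap.IsSymmetric.apply_eigenvectorBasis, T.sq_singularValues_fin hn]
    rfl
  let V : Matrix (Fin b) (Fin b) ℝ := Matrix.of fun i j => e j i
  have hV : Vᵀ * V = 1 := by
    ext i j
    have := orthonormal_iff_ite.1 e.orthonormal i j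
    rw [Matrix.one_apply, ← this, Matrix.mul_apply, PiLp.inner_apply]
    refine Finset.sum_congr rfl fun k _ => ?_
    rw [real_inner_comm]
    rfl
  refine ⟨V, fun i => T.singularValues i, fun i => T.singularValues_nonneg i, hV,
    mul_eq_one_comm.1 hV, ?_, ?_⟩
  · ext i j
    have h1 : inner ℝ (e i) ((LinearMap.adjoint T ∘ₗ T) (e j))
        = (T.singularValues j) ^ 2 * (1 : Matrix (Fin b) (Fin b) ℝ) i j := by
      rw [he, inner_smul_right, Matrix.one_apply, ← orthonormal_iff_ite.1 e.orthonormal i j]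
    rw [LinearMap.comp_apply, LinearMap.adjoint_inner_right, PiLp.inner_apply] at h1
    have h2 : (Vᵀ * (Xᵀ * X) * V) i j = ∑ k, (X * V) k i * (X * V) k j := by
      rw [show Vᵀ * (Xᵀ * X) * V = (X * V)ᵀ * (X * V) by
        rw [Matrix.transpose_mul]; simp only [Matrix.mul_assoc], Matrix.mul_apply]
      rfl
    have h3 : ∀ k j, (T (e j)) k = (X * V) k j := by
      intro k j
      rw [hT, Matrix.toLpLin_apply, Matrix.mul_apply]
      rfl
    rw [h2, Matrix.diagonal_apply]
    have h4 : ∑ k, (X * V) k i * (X * V) k j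
        = T.singularValues j ^ 2 * (1 : Matrix (Fin b) (Fin b) ℝ) i j := by
      rw [← h1]
      refine Finset.sum_congr rfl fun k _ => ?_
      rw [h3, h3, real_inner_comm]
      rfl
    rw [h4, Matrix.one_apply]
    split_ifs with h
    · rw [h, mul_one]
    · rw [mul_zero]
  · rw [nuclearNorm, Finset.sum_range]

theorem norm_sq_eq_sum_of_singular {X : Matrix (Fin a) (Fin b) ℝ} {V : Matrix (Fin b) (Fin b) ℝ}
    {d : Fin b → ℝ} (hV : V * Vᵀ = 1) (h : Vᵀ * (Xᵀ * X) * V = diagonal (fun i => d i ^ 2)) :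
    ‖X‖ ^ 2 = ∑ i, d i ^ 2 := by
  rw [frobenius_norm_sq, ← Matrix.trace_diagonal, ← h, Matrix.trace_mul_cycle, hV, Matrix.one_mul]

theorem gram_eq_of_singular {X : Matrix (Fin a) (Fin b) ℝ} {V : Matrix (Fin b) (Fin b) ℝ}
    {d : Fin b → ℝ} (hV : V * Vᵀ = 1) (h : Vᵀ * (Xᵀ * X) * V = diagonal (fun i => d i ^ 2)) :
    Xᵀ * X = V * diagonal (fun i => d i ^ 2) * Vᵀ := by
  rw [← h]
  calc Xᵀ * X = (V * Vᵀ) * (Xᵀ * X) * (V * Vᵀ) := by rw [hV, Matrix.one_mul, Matrix.mul_one]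
    _ = _ := by simp only [Matrix.mul_assoc]

theorem norm_le_nuclearNorm (X : Matrix (Fin a) (Fin b) ℝ) : ‖X‖ ≤ nuclearNorm X := by
  obtain ⟨V, d, hd, hV, hV', hX, hnuc⟩ := exists_right_singular_basis X
  rw [hnuc]
  refine abs_le_of_sq_le_sq' ?_ (Finset.sum_nonneg fun i _ => hd i) |>.2
  rw [norm_sq_eq_sum_of_singular hV' hX]
  exact Finset.sum_sq_le_sq_sum_of_nonneg fun i _ => hd i

/-- Cauchy–Schwarz over the nonzero singular values, of which there are at most `X.rank`. -/
theorem nuclearNorm_le_sqrt_rank (X : Matrix (Fin a) (Fin b) ℝ) :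
    nuclearNorm X ≤ √X.rank * ‖X‖ := by
  obtain ⟨V, d, hd, hV, hV', hX, hnuc⟩ := exists_right_singular_basis X
  have hrank : (Finset.univ.filter fun i => d i ≠ 0).card ≤ X.rank := by
    have h1 : (diagonal (fun i => d i ^ 2)).rank ≤ X.rank := by
      rw [← hX]
      refine (Matrix.rank_mul_le_left _ _).trans ((Matrix.rank_mul_le_right _ _).trans ?_)
      exact Matrix.rank_mul_le_right _ _
    rw [Matrix.rank_diagonal, Fintype.card_subtype] at h1
    simpa using h1
  have h2 : ∑ i, d i = ∑ i ∈ Finset.univ.filter (fun i => d i ≠ 0), d i :=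
    (Finset.sum_filter_ne_zero _).symm
  rw [hnuc]
  refine abs_le_of_sq_le_sq' ?_ (by positivity) |>.2
  rw [mul_pow, Real.sq_sqrt (Nat.cast_nonneg _), h2, norm_sq_eq_sum_of_singular hV' hX]
  refine sq_sum_le_card_mul_sum_sq.trans ?_
  refine mul_le_mul (by exact_mod_cast hrank) ?_ (Finset.sum_nonneg fun i _ => sq_nonneg _)
    (Nat.cast_nonneg _)
  exact Finset.sum_le_sum_of_subset_of_nonneg (Finset.filter_subset _ _)
    fun i _ _ => sq_nonneg _

theorem conj_diagonal_mul_conj_diagonal {V : Matrix (Fin b) (Fin b) ℝ} (hV : Vᵀ * V = 1)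
    (f g : Fin b → ℝ) : V * diagonal f * Vᵀ * (V * diagonal g * Vᵀ)
      = V * diagonal (fun i => f i * g i) * Vᵀ := by
  calc _ = V * diagonal f * (Vᵀ * V) * diagonal g * Vᵀ := by simp only [Matrix.mul_assoc]
    _ = _ := by rw [hV, Matrix.mul_one, Matrix.mul_assoc V, diagonal_mul_diagonal]

/-- The polar factor of a matrix certifies its nuclear norm. -/
theorem exists_polar_factor (X : Matrix (Fin a) (Fin b) ℝ) :
    ∃ Y : Matrix (Fin a) (Fin b) ℝ, (∃ L : Matrix (Fin a) (Fin a) ℝ, Y = L * X) ∧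
      (∃ G : Matrix (Fin b) (Fin b) ℝ, Y = X * G) ∧
      Yᵀ * Y * (Yᵀ * Y) = Yᵀ * Y ∧ (Xᵀ * Y).trace = nuclearNorm X := by
  obtain ⟨V, d, hd, hV, hV', hX, hnuc⟩ := exists_right_singular_basis X
  have hgram := gram_eq_of_singular hV' hX
  have hDD := conj_diagonal_mul_conj_diagonal hV
  -- With `0⁻¹ = 0` this is the pseudo-inverse of `(XᵀX)^{1/2}`, so `X * G` is the polar factor and
  -- its Gram matrix projects onto the row space of `X`.
  set G := V * diagonal (fun i => (d i)⁻¹) * Vᵀ with hG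
  have hGt : Gᵀ = G := by
    rw [hG]
    simp [Matrix.mul_assoc]
  have hYY : (X * G)ᵀ * (X * G) = V * diagonal (fun i => (d i)⁻¹ * (d i ^ 2 * (d i)⁻¹)) * Vᵀ := by
    rw [Matrix.transpose_mul, hGt]
    calc G * Xᵀ * (X * G) = G * (Xᵀ * X * G) := by simp only [Matrix.mul_assoc]
      _ = _ := by rw [hgram, hG, hDD, hDD]
  refine ⟨X * G, ⟨X * (V * diagonal (fun i => (d i)⁻¹ ^ 3) * Vᵀ) * Xᵀ, ?_⟩, ⟨G, rfl⟩, ?_, ?_⟩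
  · rw [Matrix.mul_assoc, hgram, Matrix.mul_assoc X, hDD, hG]
    congr 5
    ext i
    rcases eq_or_ne (d i) 0 with h | h
    · simp [h]
    · field_simp
  · rw [hYY, hDD]
    congr 3
    ext i
    rcases eq_or_ne (d i) 0 with h | h
    · simp [h]
    · field_simp
  · rw [← Matrix.mul_assoc, hgram, hG, hDD, Matrix.trace_mul_cycle, hV, Matrix.one_mul,
      Matrix.trace_diagonal, hnuc]
    refine Finset.sum_congr rfl fun i _ => ?_
    rcases eq_or_ne (d i) 0 with h | h
    · simp [h]
    · field_simp

/-- The hypothesis makes `YᵀY` an orthogonal projection, so `Y` is a contraction. In the right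
singular basis the columns of `X * V` have norm `d i` and those of `Y * V` norm at most 1;
Cauchy–Schwarz applies column by column. -/
theorem trace_le_nuclearNorm (X Y : Matrix (Fin a) (Fin b) ℝ)
    (hY : Yᵀ * Y * (Yᵀ * Y) = Yᵀ * Y) : (Xᵀ * Y).trace ≤ nuclearNorm X := by
  obtain ⟨V, d, hd, hV, hV', hX, hnuc⟩ := exists_right_singular_basis X
  have h1 : (Xᵀ * Y).trace = ((X * V)ᵀ * (Y * V)).trace := by
    rw [Matrix.transpose_mul, Matrix.mul_assoc, ← Matrix.mul_assoc Xᵀ, ← Matrix.mul_assoc Vᵀ,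
      Matrix.trace_mul_cycle, hV', Matrix.one_mul]
  rw [h1, hnuc, Matrix.trace]
  refine Finset.sum_le_sum fun i _ => ?_
  rw [Matrix.diag_apply, Matrix.mul_apply]
  have hXi : ∑ k, (X * V)ᵀ i k ^ 2 = d i ^ 2 := by
    have : ((X * V)ᵀ * (X * V)) i i = d i ^ 2 := by
      rw [show (X * V)ᵀ * (X * V) = Vᵀ * (Xᵀ * X) * V by
        rw [Matrix.transpose_mul]; simp only [Matrix.mul_assoc], hX, Matrix.diagonal_apply_eq]
    rw [← this, Matrix.mul_apply]
    exact Finset.sum_congr rfl fun k _ => by rw [Matrix.transpose_apply, sq]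
  have hYi : ∑ k, (Y * V) k i ^ 2 ≤ 1 := by
    set Q := Vᵀ * (Yᵀ * Y) * V with hQ
    have hQ1 : Q * Q = Q := by
      calc Q * Q = Vᵀ * ((Yᵀ * Y) * (V * Vᵀ) * (Yᵀ * Y)) * V := by
            rw [hQ]; simp only [Matrix.mul_assoc]
        _ = Q := by rw [hV', Matrix.mul_one, hY]
    have hQt : Qᵀ = Q := by
      rw [hQ]
      simp only [Matrix.transpose_mul, Matrix.transpose_transpose, Matrix.mul_assoc]
    have hq : ∑ k, (Y * V) k i ^ 2 = Q i i := by
      rw [show Q = (Y * V)ᵀ * (Y * V) by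
        rw [hQ, Matrix.transpose_mul]; simp only [Matrix.mul_assoc], Matrix.mul_apply]
      exact Finset.sum_congr rfl fun k _ => by rw [Matrix.transpose_apply, sq]
    -- For a symmetric idempotent, `Q i i` is the squared norm of column `i`, hence at least `(Q i
    -- i)²`.
    have hqq : Q i i ^ 2 ≤ Q i i := by
      have : Q i i = ∑ k, Q k i ^ 2 := by
        conv_lhs => rw [← hQ1]
        rw [Matrix.mul_apply]
        refine Finset.sum_congr rfl fun k _ => ?_
        rw [sq, ← Matrix.transpose_apply Q k i, hQt]
      conv_rhs => rw [this]
      exact Finset.single_le_sum (f := fun k => Q k i ^ 2) (fun k _ => sq_nonneg _)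
        (Finset.mem_univ i)
    rw [hq]
    nlinarith
  refine abs_le_of_sq_le_sq' ?_ (hd i) |>.2
  refine (Finset.sum_mul_sq_le_sq_mul_sq _ _ _).trans ?_
  rw [hXi]
  exact mul_le_of_le_one_right (sq_nonneg _) hYi

/-- The polar factor of `A + B` is an admissible test matrix for each summand. -/
theorem nuclearNorm_add_le (A B : Matrix (Fin a) (Fin b) ℝ) :
    nuclearNorm (A + B) ≤ nuclearNorm A + nuclearNorm B := by
  obtain ⟨Y, -, -, hY, h⟩ := exists_polar_factor (A + B)
  rw [← h, Matrix.transpose_add, Matrix.add_mul, Matrix.trace_add]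
  exact add_le_add (trace_le_nuclearNorm A Y hY) (trace_le_nuclearNorm B Y hY)

/-- The nuclear norm is superadditive on matrices with orthogonal row and column spaces. -/
theorem nuclearNorm_add_of_orthogonal {A B : Matrix (Fin a) (Fin b) ℝ} (h1 : Aᵀ * B = 0)
    (h2 : A * Bᵀ = 0) : nuclearNorm A + nuclearNorm B ≤ nuclearNorm (A + B) := by
  obtain ⟨Y, ⟨L, hL⟩, ⟨G, hG⟩, hY, hYt⟩ := exists_polar_factor A
  obtain ⟨Z, ⟨L', hL'⟩, ⟨G', hG'⟩, hZ, hZt⟩ := exists_polar_factor B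
  have h1' : Bᵀ * A = 0 := by
    rw [← Matrix.transpose_transpose A, ← Matrix.transpose_mul, h1, Matrix.transpose_zero]
  have hAZ : Aᵀ * Z = 0 := by rw [hG', ← Matrix.mul_assoc, h1, Matrix.zero_mul]
  have hBY : Bᵀ * Y = 0 := by rw [hG, ← Matrix.mul_assoc, h1', Matrix.zero_mul]
  have hYZ : Yᵀ * Z = 0 := by rw [hG, Matrix.transpose_mul, Matrix.mul_assoc, hAZ, Matrix.mul_zero]
  have hZY : Zᵀ * Y = 0 := by
    rw [hG', Matrix.transpose_mul, Matrix.mul_assoc, hBY, Matrix.mul_zero]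
  have hYZ' : Y * Zᵀ = 0 := by
    rw [hL, hL', Matrix.transpose_mul, Matrix.mul_assoc, ← Matrix.mul_assoc A, h2,
      Matrix.zero_mul, Matrix.mul_zero]
  have hZY' : Z * Yᵀ = 0 := by
    rw [← Matrix.transpose_transpose Z, ← Matrix.transpose_mul, hYZ', Matrix.transpose_zero]
  have hgram : (Y + Z)ᵀ * (Y + Z) = Yᵀ * Y + Zᵀ * Z := by
    rw [Matrix.transpose_add, Matrix.add_mul, Matrix.mul_add, Matrix.mul_add, hYZ, hZY]
    simp
  -- Orthogonality of row and column spaces passes to the polar factors, so `Y + Z` is again a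
  -- partial isometry and certifies both nuclear norms at once.
  have hidem : (Y + Z)ᵀ * (Y + Z) * ((Y + Z)ᵀ * (Y + Z)) = (Y + Z)ᵀ * (Y + Z) := by
    rw [hgram, Matrix.add_mul, Matrix.mul_add, Matrix.mul_add, hY, hZ, Matrix.mul_assoc Yᵀ Y,
      ← Matrix.mul_assoc Y Zᵀ, hYZ', Matrix.mul_assoc Zᵀ Z, ← Matrix.mul_assoc Z Yᵀ, hZY']
    simp
  have := trace_le_nuclearNorm (A + B) (Y + Z) hidem
  rw [Matrix.transpose_add, Matrix.add_mul, Matrix.mul_add, Matrix.mul_add, hAZ, hBY, add_zero,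
    zero_add, Matrix.trace_add, hYt, hZt] at this
  exact this

theorem continuous_nuclearNorm :
    Continuous (nuclearNorm : Matrix (Fin a) (Fin b) ℝ → ℝ) := by
  refine (LipschitzWith.of_le_add_mul (NNReal.sqrt b) fun A B => ?_).continuous
  have h1 := nuclearNorm_add_le B (A - B)
  rw [add_sub_cancel] at h1
  refine h1.trans (add_le_add_right ?_ _)
  refine (nuclearNorm_le_sqrt_rank _).trans ?_
  rw [dist_eq_norm]
  refine mul_le_mul_of_nonneg_right ?_ (norm_nonneg _)
  rw [Real.coe_sqrt]
  refine Real.sqrt_le_sqrt ?_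
  simpa using (A - B).rank_le_width

/-- Decomposition of a matrix into pairwise orthogonal rank-one matrices. -/
theorem exists_singular_decomposition (X : Matrix (Fin a) (Fin b) ℝ) :
    ∃ w : Fin b → Matrix (Fin a) (Fin b) ℝ, ∑ i, w i = X ∧
      (∀ i j, i ≠ j → inner ℝ (w i) (w j) = 0) ∧ ∑ i, ‖w i‖ = nuclearNorm X ∧
      (∀ i, (w i).rank ≤ 1) ∧ (∀ i, ∃ L : Matrix (Fin a) (Fin a) ℝ, w i = L * X) ∧
      ∀ i, ∃ R : Matrix (Fin b) (Fin b) ℝ, w i = X * R := by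
  obtain ⟨V, d, hd, hV, hV', hX, hnuc⟩ := exists_right_singular_basis X
  have hgram := gram_eq_of_singular hV' hX
  let p : Fin b → Fin b → ℝ := fun i => Pi.single i 1
  -- With `v` the `i`-th column of `V`, this is `X v vᵀ`.
  let w : Fin b → Matrix (Fin a) (Fin b) ℝ := fun i => X * (V * diagonal (p i) * Vᵀ)
  have hDD := conj_diagonal_mul_conj_diagonal hV
  have hin : ∀ i j, inner ℝ (w i) (w j) = ∑ k, p i k * (d k ^ 2 * p j k) := by
    intro i j
    rw [frobenius_inner_eq]
    have : (w i)ᵀ * w j = V * diagonal (fun k => p i k * (d k ^ 2 * p j k)) * Vᵀ := by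
      calc (w i)ᵀ * w j = (V * diagonal (p i) * Vᵀ)ᵀ * ((Xᵀ * X) * (V * diagonal (p j) * Vᵀ)) := by
            simp only [w, Matrix.transpose_mul X, Matrix.mul_assoc]
        _ = (V * diagonal (p i) * Vᵀ) * ((Xᵀ * X) * (V * diagonal (p j) * Vᵀ)) := by
            congr 1
            simp [Matrix.mul_assoc]
        _ = _ := by rw [hgram, hDD, hDD]
    rw [this, Matrix.trace_mul_cycle, hV, Matrix.one_mul, Matrix.trace_diagonal]
  have hnorm : ∀ i, ‖w i‖ = d i := by
    intro i
    have : ‖w i‖ ^ 2 = d i ^ 2 := by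
      rw [← real_inner_self_eq_norm_sq, hin, Finset.sum_eq_single i]
      · simp [p]
      · intro k _ hk
        simp [p, hk]
      · simp
    exact (sq_eq_sq₀ (norm_nonneg _) (hd i)).1 this
  refine ⟨w, ?_, ?_, ?_, ?_, ?_, fun i => ⟨_, rfl⟩⟩
  · rw [← Matrix.mul_sum, ← Finset.sum_mul, ← Finset.mul_sum]
    have : ∑ i, diagonal (p i) = (1 : Matrix (Fin b) (Fin b) ℝ) := by
      ext k l
      rw [Matrix.sum_apply, Matrix.one_apply]
      by_cases h : k = l
      · subst h
        simp [p, Pi.single_apply]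
      · simp [h]
    rw [this, Matrix.mul_one, hV', Matrix.mul_one]
  · intro i j hij
    rw [hin]
    refine Finset.sum_eq_zero fun k _ => ?_
    by_cases h : k = i
    · subst h
      simp [p, hij]
    · simp [p, h]
  · rw [hnuc]
    exact Finset.sum_congr rfl fun i _ => hnorm i
  · intro i
    refine (Matrix.rank_mul_le_right _ _).trans ((Matrix.rank_mul_le_left _ _).trans
      ((Matrix.rank_mul_le_right _ _).trans ?_))
    rw [Matrix.rank_diagonal, Fintype.card_subtype]
    refine (Finset.card_le_card (t := {i}) ?_).trans (by simp)
    intro k hk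
    by_contra h
    have hki : k ≠ i := by simpa using h
    simp [p, Pi.single_eq_of_ne hki] at hk
  · intro i
    rcases eq_or_ne (d i) 0 with h | h
    · refine ⟨0, ?_⟩
      rw [Matrix.zero_mul, ← norm_eq_zero, hnorm, h]
    · refine ⟨X * (V * diagonal (fun k => p i k * (d i ^ 2)⁻¹) * Vᵀ) * Xᵀ, ?_⟩
      rw [Matrix.mul_assoc, hgram, Matrix.mul_assoc X, hDD]
      simp only [w]
      congr 4
      ext k
      by_cases hk : k = i
      · subst hk
        field_simp
      · simp [p, hk]

/-- The orthogonal projection onto the column space of a matrix. -/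
theorem exists_column_projection (X : Matrix (Fin a) (Fin b) ℝ) :
    ∃ P : Matrix (Fin a) (Fin a) ℝ, Pᵀ = P ∧ P * P = P ∧ P * X = X ∧ P.rank ≤ X.rank := by
  obtain ⟨V, d, hd, hV, hV', hX, hnuc⟩ := exists_right_singular_basis X
  have hgram := gram_eq_of_singular hV' hX
  have hDD := conj_diagonal_mul_conj_diagonal hV
  set G := V * diagonal (fun i => (d i ^ 2)⁻¹) * Vᵀ with hG
  have hGt : Gᵀ = G := by
    rw [hG]
    simp [Matrix.mul_assoc]
  have hfix : X * G * Xᵀ * X = X := by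
    rw [Matrix.mul_assoc, hgram, Matrix.mul_assoc X, hDD]
    -- Where `d i = 0` the diagonal entry is `0`, but column `i` of `X * V` has norm `d i` and
    -- vanishes too.
    have hcol : X * V * diagonal (fun i => (d i ^ 2)⁻¹ * d i ^ 2) = X * V := by
      ext k i
      rw [Matrix.mul_diagonal]
      rcases eq_or_ne (d i) 0 with h | h
      · have : ∑ k, (X * V) k i ^ 2 = 0 := by
          have h2 : ((X * V)ᵀ * (X * V)) i i = d i ^ 2 := by
            rw [show (X * V)ᵀ * (X * V) = Vᵀ * (Xᵀ * X) * V by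
              rw [Matrix.transpose_mul]; simp only [Matrix.mul_assoc], hX,
              Matrix.diagonal_apply_eq]
          rw [h, Matrix.mul_apply] at h2
          rw [← (show (0 : ℝ) ^ 2 = 0 by norm_num), ← h2]
          exact Finset.sum_congr rfl fun k _ => by rw [Matrix.transpose_apply, sq]
        have h3 := (Finset.sum_eq_zero_iff_of_nonneg fun k _ => sq_nonneg _).1 this k
          (Finset.mem_univ k)
        rw [pow_eq_zero_iff two_ne_zero] at h3
        rw [h3, zero_mul]
      · rw [inv_mul_cancel₀ (pow_ne_zero 2 h), mul_one]
    calc _ = X * V * diagonal (fun i => (d i ^ 2)⁻¹ * d i ^ 2) * Vᵀ := by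
          simp only [Matrix.mul_assoc]
      _ = X := by rw [hcol, Matrix.mul_assoc, hV', Matrix.mul_one]
  refine ⟨X * G * Xᵀ, ?_, ?_, hfix, ?_⟩
  · rw [Matrix.transpose_mul, Matrix.transpose_mul, hGt, Matrix.transpose_transpose]
    exact (Matrix.mul_assoc _ _ _).symm
  · rw [← Matrix.mul_assoc, ← Matrix.mul_assoc, hfix]
  · exact (Matrix.rank_mul_le_left _ _).trans (Matrix.rank_mul_le_left _ _)

end Nuclear

/-! ### Rank bounds and the nuclear norm stage -/

section Rank

variable {a b : ℕ}

theorem matrix_rank_add_le (A B : Matrix (Fin a) (Fin b) ℝ) : (A + B).rank ≤ A.rank + B.rank := by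
  rw [Matrix.rank, Matrix.rank, Matrix.rank, Matrix.mulVecLin_add]
  refine (Submodule.finrank_mono ?_).trans (Submodule.finrank_add_le_finrank_add_finrank _ _)
  rintro _ ⟨x, rfl⟩
  exact Submodule.add_mem_sup ⟨x, rfl⟩ ⟨x, rfl⟩

theorem matrix_rank_smul_le (t : ℝ) (A : Matrix (Fin a) (Fin b) ℝ) : (t • A).rank ≤ A.rank := by
  have : t • A = A * (t • (1 : Matrix (Fin b) (Fin b) ℝ)) := by simp
  rw [this]
  exact Matrix.rank_mul_le_left _ _

theorem matrix_rank_sum_le {ι : Type*} (I : Finset ι) (w : ι → Matrix (Fin a) (Fin b) ℝ)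
    (hw : ∀ i, (w i).rank ≤ 1) : (∑ i ∈ I, w i).rank ≤ I.card := by
  classical
  induction I using Finset.induction_on with
  | empty => simp
  | insert i I hi ih =>
    rw [Finset.sum_insert hi, Finset.card_insert_of_notMem hi, add_comm I.card]
    exact (matrix_rank_add_le _ _).trans (add_le_add (hw i) ih)

end Rank

/-- Stability of nuclear norm minimization. -/
theorem IsLowRankRIP.norm_le {m b n r : ℕ} {δ : ℝ}
    {W : Matrix (Fin m) (Fin b) ℝ →ₗ[ℝ] EuclideanSpace ℝ (Fin n)}
    (hW : IsLowRankRIP W (4 * r) δ) (hδ : δ ≤ 1 / 10) (hr : 1 ≤ r)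
    {B H : Matrix (Fin m) (Fin b) ℝ} (hB : B.rank ≤ r)
    (hmin : nuclearNorm (B + H) ≤ nuclearNorm B) : ‖H‖ ≤ 6 * ‖W H‖ := by
  obtain ⟨P, hPt, hPP, hPB, hPr⟩ := exists_column_projection B
  obtain ⟨Q, hQt, hQQ, hQB, hQr⟩ := exists_column_projection Bᵀ
  rw [Matrix.rank_transpose] at hQr
  have hBQ : B * Q = B := by
    rw [← Matrix.transpose_transpose (B * Q), Matrix.transpose_mul, hQt, hQB,
      Matrix.transpose_transpose]
  -- `H₁` has row and column spaces orthogonal to those of `B`; the remainder `H₀` has rank at most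
  -- `2r`.
  set H₁ := (1 - P) * H * (1 - Q) with hH₁
  set H₀ := P * H + (1 - P) * H * Q with hH₀
  have hsum : H₀ + H₁ = H := by
    rw [hH₀, hH₁, Matrix.mul_sub, Matrix.sub_mul]
    simp only [Matrix.mul_one, Matrix.one_mul]
    abel
  have hP1 : P * (1 - P) = 0 := by rw [Matrix.mul_sub, hPP, Matrix.mul_one, sub_self]
  have hQ1 : (1 - Q) * Q = 0 := by rw [Matrix.sub_mul, hQQ, Matrix.one_mul, sub_self]
  have hPH : P * H₁ = 0 := by
    rw [hH₁, ← Matrix.mul_assoc, ← Matrix.mul_assoc, hP1, Matrix.zero_mul, Matrix.zero_mul]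
  have hHQ : H₁ * Q = 0 := by rw [hH₁, Matrix.mul_assoc, hQ1, Matrix.mul_zero]
  have horth1 : Bᵀ * H₁ = 0 := by
    rw [← hPB, Matrix.transpose_mul, hPt, Matrix.mul_assoc, hPH, Matrix.mul_zero]
  have horth2 : B * H₁ᵀ = 0 := by
    rw [← hBQ, Matrix.mul_assoc, ← hQt, ← Matrix.transpose_mul, hHQ, Matrix.transpose_zero,
      Matrix.mul_zero]
  have hrank : H₀.rank ≤ 2 * r := by
    have h1 : (P * H).rank ≤ r := (Matrix.rank_mul_le_left _ _).trans (hPr.trans hB)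
    have h2 : ((1 - P) * H * Q).rank ≤ r := (Matrix.rank_mul_le_right _ _).trans (hQr.trans hB)
    exact (matrix_rank_add_le (P * H) ((1 - P) * H * Q)).trans (by omega)
  have hneg : nuclearNorm (-H₀) ≤ √((2 * r : ℕ) : ℝ) * ‖H₀‖ := by
    refine (nuclearNorm_le_sqrt_rank _).trans ?_
    rw [norm_neg]
    refine mul_le_mul_of_nonneg_right (Real.sqrt_le_sqrt ?_) (norm_nonneg _)
    have : (-H₀).rank ≤ H₀.rank := by
      rw [← neg_one_smul ℝ H₀]
      exact matrix_rank_smul_le _ _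
    exact_mod_cast this.trans hrank
  -- `‖B‖_* + ‖H₁‖_* ≤ ‖B + H₁‖_* ≤ ‖B + H‖_* + ‖H₀‖_*`, and minimality cancels `‖B‖_*`.
  have hcone : nuclearNorm H₁ ≤ √((2 * r : ℕ) : ℝ) * ‖H₀‖ := by
    have h1 := nuclearNorm_add_of_orthogonal horth1 horth2
    have h2 := nuclearNorm_add_le (B + H) (-H₀)
    rw [show B + H + -H₀ = B + H₁ by rw [← hsum]; abel] at h2
    linarith
  obtain ⟨w, hwsum, hworth, hwnorm, hwrank, hwL, hwR⟩ := exists_singular_decomposition H₁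
  have hw0 : ∀ i, inner ℝ H₀ (w i) = 0 := by
    intro i
    obtain ⟨L, hL⟩ := hwL i
    obtain ⟨R, hR⟩ := hwR i
    rw [hH₀, inner_add_left, frobenius_inner_eq, frobenius_inner_eq]
    have h1 : (P * H)ᵀ * w i = 0 := by
      rw [hR, Matrix.transpose_mul, hPt, Matrix.mul_assoc, ← Matrix.mul_assoc P, hPH,
        Matrix.zero_mul, Matrix.mul_zero]
    have h2 : (((1 - P) * H * Q)ᵀ * w i).trace = 0 := by
      rw [Matrix.transpose_mul, hQt, Matrix.trace_mul_cycle, hL, Matrix.mul_assoc L, hHQ,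
        Matrix.mul_zero, Matrix.zero_mul, Matrix.trace_zero]
    rw [h1, h2, Matrix.trace_zero, add_zero]
  rw [← hsum, ← hwsum]
  -- Blocks of `2r` rank-one atoms match the rank of `H₀`; any two pieces together have rank at most
  -- `4r`.
  refine norm_le_of_nearIsometryAt W hW.1 hδ (s := 2 * r) (by omega) H₀ w hworth hw0 ?_ ?_ ?_
  · rw [hwnorm]
    exact hcone
  · intro I hI s t
    refine hW.2.2 _ ((matrix_rank_add_le _ _).trans ?_)
    have h1 := matrix_rank_smul_le s H₀
    have h2 := (matrix_rank_smul_le t (∑ i ∈ I, w i)).trans (matrix_rank_sum_le I w hwrank)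
    omega
  · intro I J hI hJ s t
    refine hW.2.2 _ ((matrix_rank_add_le _ _).trans ?_)
    have h1 := (matrix_rank_smul_le s (∑ i ∈ I, w i)).trans (matrix_rank_sum_le I w hwrank)
    have h2 := (matrix_rank_smul_le t (∑ i ∈ J, w i)).trans (matrix_rank_sum_le J w hwrank)
    omega

/-! ### Row restrictions and the row-sum norm stage -/

section RowSum

variable {a b : ℕ}

theorem frobenius_norm_sq_eq_sum_rows (X : Matrix (Fin a) (Fin b) ℝ) :
    ‖X‖ ^ 2 = ∑ i, ‖WithLp.toLp 2 (X.row i)‖ ^ 2 := by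
  rw [Matrix.frobenius_norm_def, ← Real.sqrt_eq_rpow, Real.sq_sqrt (by positivity)]
  refine Finset.sum_congr rfl fun i _ => ?_
  rw [EuclideanSpace.norm_sq_eq]
  simp

theorem norm_le_rowSumNorm (X : Matrix (Fin a) (Fin b) ℝ) : ‖X‖ ≤ rowSumNorm X := by
  refine abs_le_of_sq_le_sq' ?_ (Finset.sum_nonneg fun i _ => norm_nonneg _) |>.2
  rw [frobenius_norm_sq_eq_sum_rows]
  exact Finset.sum_sq_le_sq_sum_of_nonneg fun i _ => norm_nonneg _

theorem continuous_rowSumNorm :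
    Continuous (rowSumNorm : Matrix (Fin a) (Fin b) ℝ → ℝ) := by
  refine continuous_finsetSum _ fun i _ => continuous_norm.comp ?_
  refine (PiLp.continuous_toLp 2 _).comp ?_
  exact continuous_pi fun j => continuous_id.matrix_elem i j

/-- The matrix with the rows outside `S` replaced by zero. -/
noncomputable def rowRestrict (S : Finset (Fin a)) (X : Matrix (Fin a) (Fin b) ℝ) :
    Matrix (Fin a) (Fin b) ℝ :=
  Matrix.of fun i j => if i ∈ S then X i j else 0

theorem row_rowRestrict (S : Finset (Fin a)) (X : Matrix (Fin a) (Fin b) ℝ) (i : Fin a) :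
    (rowRestrict S X).row i = if i ∈ S then X.row i else 0 := by
  ext j
  simp only [rowRestrict, Matrix.row_apply, Matrix.of_apply]
  split_ifs <;> rfl

theorem rowRestrict_sum (I : Finset (Fin a)) (X : Matrix (Fin a) (Fin b) ℝ) :
    ∑ i ∈ I, rowRestrict {i} X = rowRestrict I X := by
  ext k j
  simp [Matrix.sum_apply, rowRestrict]

theorem norm_rowRestrict_sq (S : Finset (Fin a)) (X : Matrix (Fin a) (Fin b) ℝ) :
    ‖rowRestrict S X‖ ^ 2 = ∑ i ∈ S, ‖WithLp.toLp 2 (X.row i)‖ ^ 2 := by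
  rw [frobenius_norm_sq_eq_sum_rows, ← Finset.sum_subset (Finset.subset_univ S)]
  · exact Finset.sum_congr rfl fun i hi => by rw [row_rowRestrict, if_pos hi]
  · intro i _ hi
    rw [row_rowRestrict, if_neg hi]
    simp

theorem numNonzeroRows_le_card (S : Finset (Fin a)) (X : Matrix (Fin a) (Fin b) ℝ)
    (h : ∀ i ∉ S, X.row i = 0) : numNonzeroRows X ≤ S.card := by
  rw [numNonzeroRows, ← Set.ncard_coe_finset]
  refine Set.ncard_le_ncard (fun i hi => ?_) (Finset.finite_toSet S)
  by_contra hS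
  exact hi (h i hS)

theorem inner_rowRestrict_of_disjoint {S T : Finset (Fin a)} (h : Disjoint S T)
    (X Y : Matrix (Fin a) (Fin b) ℝ) : inner ℝ (rowRestrict S X) (rowRestrict T Y) = 0 := by
  have : (rowRestrict S X)ᵀ * rowRestrict T Y = 0 := by
    ext j k
    rw [Matrix.mul_apply]
    refine Finset.sum_eq_zero fun i _ => ?_
    simp only [Matrix.transpose_apply, rowRestrict, Matrix.of_apply]
    split_ifs with h1 h2
    · exact absurd h2 (Finset.disjoint_left.1 h h1)
    all_goals simp
  rw [frobenius_inner_eq, this, Matrix.trace_zero]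

end RowSum

/-- Stability of row-sum norm minimization. -/
theorem IsRowSparseRIP.norm_le {m a b k : ℕ} {δ : ℝ} {Ψ : Matrix (Fin m) (Fin a) ℝ}
    (hΨ : IsRowSparseRIP b Ψ (2 * k) δ) (hδ : δ ≤ 1 / 10) (hk : 1 ≤ k)
    {X H : Matrix (Fin a) (Fin b) ℝ} (hX : numNonzeroRows X ≤ k)
    (hmin : rowSumNorm (X + H) ≤ rowSumNorm X) : ‖H‖ ≤ 6 * ‖Ψ * H‖ := by
  classical
  set S : Finset (Fin a) := Finset.univ.filter fun i => X.row i ≠ 0 with hS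
  have hScard : S.card ≤ k := by
    rw [← Set.ncard_coe_finset]
    simpa [hS, numNonzeroRows] using hX
  have hXS : ∀ i ∉ S, X.row i = 0 := fun i hi => by simpa [hS] using hi
  let A : Matrix (Fin a) (Fin b) ℝ →ₗ[ℝ] Matrix (Fin m) (Fin b) ℝ :=
    { toFun := fun Z => Ψ * Z
      map_add' := fun _ _ => Matrix.mul_add _ _ _
      map_smul' := fun _ _ => Matrix.mul_smul _ _ _ }
  let w : Fin a → Matrix (Fin a) (Fin b) ℝ := fun i => rowRestrict {i} (rowRestrict Sᶜ H)
  have hwsum : ∀ I, ∑ i ∈ I, w i = rowRestrict I (rowRestrict Sᶜ H) :=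
    fun I => rowRestrict_sum I _
  have hsum : rowRestrict S H + ∑ i, w i = H := by
    rw [hwsum]
    ext i j
    by_cases h : i ∈ S <;> simp [rowRestrict, h]
  have hwnorm : ∀ i, ‖w i‖ = ‖WithLp.toLp 2 ((rowRestrict Sᶜ H).row i)‖ := by
    intro i
    rw [← sq_eq_sq₀ (norm_nonneg _) (norm_nonneg _), norm_rowRestrict_sq, Finset.sum_singleton]
  have hwsupp : ∀ I i, i ∉ I → (∑ i ∈ I, w i).row i = 0 := by
    intro I i hi
    rw [hwsum, row_rowRestrict, if_neg hi]
  have hRIP : ∀ Z : Matrix (Fin a) (Fin b) ℝ, ∀ T : Finset (Fin a), T.card ≤ 2 * k →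
      (∀ i ∉ T, Z.row i = 0) → NearIsometryAt A δ Z :=
    fun Z T hT hZ => hΨ.2.2 Z ((numNonzeroRows_le_card T Z hZ).trans hT)
  have hnorms : ∑ i, ‖w i‖ ≤ ∑ i ∈ S, ‖WithLp.toLp 2 (H.row i)‖ := by
    have h1 : ∑ i, ‖w i‖ = ∑ i ∈ Sᶜ, ‖WithLp.toLp 2 (H.row i)‖ := by
      rw [← Finset.sum_subset (Finset.subset_univ Sᶜ)]
      · refine Finset.sum_congr rfl fun i hi => ?_
        rw [hwnorm, row_rowRestrict, if_pos hi]
      · intro i _ hi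
        rw [hwnorm, row_rowRestrict, if_neg hi]
        simp
    rw [h1]
    have h2 : rowSumNorm X = ∑ i ∈ S, ‖WithLp.toLp 2 (X.row i)‖ := by
      rw [rowSumNorm, ← Finset.sum_subset (Finset.subset_univ S)]
      intro i _ hi
      rw [hXS i hi]
      simp
    -- Reverse triangle inequality on the support `S` of `X`; off `S` the rows of `X + H` are those
    -- of `H`.
    have h3 : ∑ i ∈ S, (‖WithLp.toLp 2 (X.row i)‖ - ‖WithLp.toLp 2 (H.row i)‖)
        + ∑ i ∈ Sᶜ, ‖WithLp.toLp 2 (H.row i)‖ ≤ rowSumNorm (X + H) := by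
      rw [rowSumNorm, ← Finset.sum_add_sum_compl S]
      refine add_le_add (Finset.sum_le_sum fun i _ => ?_) (Finset.sum_le_sum fun i hi => ?_)
      · have := norm_sub_norm_le (WithLp.toLp 2 (X.row i)) (-WithLp.toLp 2 (H.row i))
        rw [norm_neg, sub_neg_eq_add] at this
        exact this
      · have h0 := hXS i (Finset.mem_compl.1 hi)
        have : (X + H).row i = H.row i := by
          change X.row i + H.row i = H.row i
          rw [h0, zero_add]
        rw [this]
    rw [Finset.sum_sub_distrib] at h3
    linarith
  have hcone : ∑ i, ‖w i‖ ≤ √k * ‖rowRestrict S H‖ := by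
    refine hnorms.trans ?_
    refine abs_le_of_sq_le_sq' ?_ (by positivity) |>.2
    rw [mul_pow, Real.sq_sqrt (Nat.cast_nonneg _), norm_rowRestrict_sq]
    refine sq_sum_le_card_mul_sum_sq.trans ?_
    exact mul_le_mul_of_nonneg_right (by exact_mod_cast hScard)
      (Finset.sum_nonneg fun i _ => sq_nonneg _)
  have hcomb : ∀ (s t : ℝ) (Y Z : Matrix (Fin a) (Fin b) ℝ) (T U : Finset (Fin a)),
      (∀ i ∉ T, Y.row i = 0) → (∀ i ∉ U, Z.row i = 0) → T.card ≤ k → U.card ≤ k →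
      NearIsometryAt A δ (s • Y + t • Z) := by
    intro s t Y Z T U hY hZ hT hU
    refine hRIP _ (T ∪ U) ((Finset.card_union_le _ _).trans (by omega)) fun i hi => ?_
    rw [Finset.mem_union, not_or] at hi
    change s • Y.row i + t • Z.row i = 0
    rw [hY i hi.1, hZ i hi.2, smul_zero, smul_zero, add_zero]
  have hS0 : ∀ i ∉ S, (rowRestrict S H).row i = 0 := fun i hi => by
    rw [row_rowRestrict, if_neg hi]
  have key := norm_le_of_nearIsometryAt A hΨ.1 hδ hk (rowRestrict S H) w
    (fun i j hij => inner_rowRestrict_of_disjoint (by simpa using hij) _ _) (fun i => ?_) hcone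
    (fun I hI s t => hcomb s t _ _ S I hS0 (hwsupp I) hScard hI)
    (fun I J hI hJ s t => hcomb s t _ _ I J (hwsupp I) (hwsupp J) hI hJ)
  · rw [hsum] at key
    exact key
  · by_cases hi : i ∈ S
    · have : w i = 0 := by
        rw [← norm_eq_zero, hwnorm, row_rowRestrict, if_neg (by simpa using hi)]
        simp
      rw [this, inner_zero_right]
    · exact inner_rowRestrict_of_disjoint (by simpa using hi) _ _

/-! ### Gaussian noise tail -/

/-- The chi-square moment generating function `(1 - 2λ)^{-1/2}` at `λ = 1/4`. -/
theorem integral_exp_sq_div_four_gaussianReal :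
    ∫ x, Real.exp (x ^ 2 / 4) ∂(gaussianReal 0 1) = √2 := by
  rw [integral_gaussianReal_eq_integral_smul one_ne_zero]
  have : ∀ x : ℝ, gaussianPDFReal 0 1 x • Real.exp (x ^ 2 / 4)
      = (√(2 * Real.pi))⁻¹ * Real.exp (-(1 / 4) * x ^ 2) := by
    intro x
    rw [gaussianPDFReal, smul_eq_mul, mul_assoc, ← Real.exp_add]
    simp only [NNReal.coe_one, mul_one, sub_zero]
    congr 2
    ring
  simp_rw [this]
  rw [integral_const_mul, integral_gaussian, inv_mul_eq_div, ← Real.sqrt_div (by positivity)]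
  congr 1
  field_simp
  norm_num

theorem chernoff_standard_gaussian (n : ℕ) (t : ℝ) :
    (Measure.pi fun _ : Fin n => gaussianReal 0 1) {x | t ≤ ∑ i, x i ^ 2}
      ≤ ENNReal.ofReal (√2 ^ n * Real.exp (-(t / 4))) := by
  set μ := Measure.pi fun _ : Fin n => gaussianReal 0 1 with hμ
  have hprod : ∀ x : Fin n → ℝ, Real.exp ((∑ i, x i ^ 2) / 4) = ∏ i, Real.exp (x i ^ 2 / 4) := by
    intro x
    rw [Finset.sum_div, Real.exp_sum]
  have hint : ∫ x, Real.exp ((∑ i, x i ^ 2) / 4) ∂μ = √2 ^ n := by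
    simp_rw [hprod]
    rw [hμ, integral_fintype_prod_eq_prod (fun _ : Fin n => fun y : ℝ => Real.exp (y ^ 2 / 4))]
    simp [integral_exp_sq_div_four_gaussianReal]
  have hintegrable : Integrable (fun x => Real.exp ((∑ i, x i ^ 2) / 4)) μ := by
    -- A non-integrable function has integral `0` by convention, contradicting the positive value
    -- `√2 ^ n`.
    by_contra h
    rw [integral_undef h] at hint
    have : (0 : ℝ) < √2 ^ n := by positivity
    linarith
  have hmarkov := mul_meas_ge_le_integral_of_nonneg
    (Filter.Eventually.of_forall fun x => (Real.exp_pos _).le) hintegrable (Real.exp (t / 4))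
  rw [hint] at hmarkov
  have hset : {x : Fin n → ℝ | t ≤ ∑ i, x i ^ 2}
      ⊆ {x | Real.exp (t / 4) ≤ Real.exp ((∑ i, x i ^ 2) / 4)} := by
    intro x hx
    exact Real.exp_le_exp.2 (div_le_div_of_nonneg_right hx (by norm_num))
  refine (measure_mono hset).trans ?_
  rw [← ofReal_measureReal]
  refine ENNReal.ofReal_le_ofReal ?_
  rw [Real.exp_neg, ← div_eq_mul_inv, le_div_iff₀ (Real.exp_pos _), mul_comm]
  exact hmarkov

-- The covariance has square root `σ • 1`, also for `σ = 0`, so the noise is a scaled standard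
-- Gaussian vector.
open scoped MatrixOrder in
theorem noiseLaw_eq_map (n : ℕ) {σ : ℝ} (hσ : 0 ≤ σ) :
    noiseLaw n σ = (Measure.pi fun _ : Fin n => gaussianReal 0 1).map
      (fun x => σ • WithLp.toLp 2 x) := by
  have hsqrt : CFC.sqrt (σ ^ 2 • (1 : Matrix (Fin n) (Fin n) ℝ)) = σ • 1 := by
    refine CFC.sqrt_unique ?_ ?_
    · simp [smul_smul, sq]
    · rw [Matrix.nonneg_iff_posSemidef]
      exact Matrix.PosSemidef.one.smul hσ
  rw [noiseLaw, multivariateGaussian, hsqrt, ← map_pi_eq_stdGaussian,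
    Measure.map_map (by fun_prop) (by fun_prop)]
  congr 1
  ext1 x
  simp

theorem noiseLaw_norm_gt_le (n : ℕ) {σ t : ℝ} (hσ : 0 ≤ σ) :
    noiseLaw n σ {z | ¬ ‖z‖ ≤ σ * √t} ≤ ENNReal.ofReal (√2 ^ n * Real.exp (-(t / 4))) := by
  refine le_trans ?_ (chernoff_standard_gaussian n t)
  rw [noiseLaw_eq_map n hσ, Measure.map_apply (by fun_prop)]
  · refine measure_mono fun x hx => ?_
    by_contra hlt
    refine hx ?_
    rw [norm_smul, Real.norm_of_nonneg hσ]
    refine mul_le_mul_of_nonneg_left (Real.le_sqrt_of_sq_le ?_) hσ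
    rw [EuclideanSpace.real_norm_sq_eq]
    exact (not_le.1 hlt).le
  · exact (isClosed_le continuous_norm continuous_const).measurableSet.compl

/-- With `√2 ≤ e^{1/2}` the Chernoff exponent is at most `n/2 - n/4 - (c + 1)u`, and `n/4 ≤ cu`
leaves `-u`. The factor `4` is slack. -/
theorem noiseLaw_feasible {n : ℕ} {c σ u : ℝ} (hσ : 0 ≤ σ)
    (hn : (n : ℝ) ≤ c * u) :
    noiseLaw n σ {z | ¬ ‖z‖ ≤ σ * √((n : ℝ) + (4 * c + 4) * u)}
      ≤ ENNReal.ofReal (4 * Real.exp (-1 * u)) := by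
  refine (noiseLaw_norm_gt_le n hσ).trans (ENNReal.ofReal_le_ofReal ?_)
  have h2 : √2 ≤ Real.exp (1 / 2) := by
    rw [Real.sqrt_le_left (Real.exp_pos _).le, ← Real.exp_nat_mul]
    have := Real.add_one_le_exp 1
    norm_num at this ⊢
    linarith
  have h3 : √2 ^ n ≤ Real.exp (n / 2) := by
    refine (pow_le_pow_left₀ (Real.sqrt_nonneg _) h2 n).trans_eq ?_
    rw [← Real.exp_nat_mul]
    ring_nf
  calc √2 ^ n * Real.exp (-(((n : ℝ) + (4 * c + 4) * u) / 4))
      ≤ Real.exp (n / 2) * Real.exp (-(((n : ℝ) + (4 * c + 4) * u) / 4)) :=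
        mul_le_mul_of_nonneg_right h3 (Real.exp_pos _).le
    _ = Real.exp (n / 2 + -(((n : ℝ) + (4 * c + 4) * u) / 4)) := (Real.exp_add _ _).symm
    _ ≤ Real.exp (-1 * u) := by
        refine Real.exp_le_exp.2 ?_
        linarith
    _ ≤ 4 * Real.exp (-1 * u) := by linarith [Real.exp_pos (-1 * u)]

/-! ### Combining the two stages -/

theorem lowRankStage_nonempty {m b n r : ℕ}
    (W : Matrix (Fin m) (Fin b) ℝ →ₗ[ℝ] EuclideanSpace ℝ (Fin n)) {y : EuclideanSpace ℝ (Fin n)}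
    {σ c₁ : ℝ} {B : Matrix (Fin m) (Fin b) ℝ}
    (hB : ‖W B - y‖ ≤ σ * √((n : ℝ) + c₁ * ((r : ℝ) * max (m : ℝ) (b : ℝ)))) :
    (lowRankStage W y σ c₁ r).Nonempty := by
  refine argminOver_nonempty continuous_nuclearNorm norm_le_nuclearNorm ?_ ⟨B, hB⟩
  have hW : Continuous W := LinearMap.continuous_of_finiteDimensional W
  exact isClosed_le (hW.sub continuous_const).norm continuous_const

theorem sparseStage_nonempty {m a b r : ℕ} (Ψ : Matrix (Fin m) (Fin a) ℝ)
    {Bhat : Matrix (Fin m) (Fin b) ℝ} {σ c₂ : ℝ} {X : Matrix (Fin a) (Fin b) ℝ}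
    (hX : ‖Ψ * X - Bhat‖ ≤ c₂ * σ * √((r : ℝ) * max (m : ℝ) (b : ℝ))) :
    (sparseStage Ψ Bhat σ c₂ r).Nonempty := by
  refine argminOver_nonempty continuous_rowSumNorm norm_le_rowSumNorm ?_ ⟨X, hX⟩
  exact isClosed_le ((continuous_const.matrix_mul continuous_id).sub continuous_const).norm
    continuous_const

theorem theorem1 :
    ∃ δ₀ : ℝ, 0 < δ₀ ∧ ∀ c : ℝ, 0 < c →
    ∃ c₁ c₂ : ℝ, 0 < c₁ ∧ 0 < c₂ ∧ ∃ C c₀ : ℝ, 0 < C ∧ 0 < c₀ ∧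
    ∀ (p₁ p₂ m n k r : ℕ), 1 ≤ k → 1 ≤ r →
    (n : ℝ) ≤ c * ((r : ℝ) * max (m : ℝ) (p₂ : ℝ)) →
    ∀ (Ψ : Matrix (Fin m) (Fin p₁) ℝ)
      (W : Matrix (Fin m) (Fin p₂) ℝ →ₗ[ℝ] EuclideanSpace ℝ (Fin n))
      (δΨ δW : ℝ), δΨ ≤ δ₀ → δW ≤ δ₀ →
    IsRowSparseRIP p₂ Ψ (2 * k) δΨ → IsLowRankRIP W (4 * r) δW →
    ∀ σ : ℝ, 0 ≤ σ →
    noiseLaw n σ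
      {z | ¬ ∀ X : Matrix (Fin p₁) (Fin p₂) ℝ, numNonzeroRows X ≤ k → X.rank ≤ r →
        (lowRankStage W (W (Ψ * X) + z) σ c₁ r).Nonempty ∧
        ∀ Bhat ∈ lowRankStage W (W (Ψ * X) + z) σ c₁ r,
          (sparseStage Ψ Bhat σ c₂ r).Nonempty ∧
          ∀ Xhat ∈ sparseStage Ψ Bhat σ c₂ r,
            ‖Xhat - X‖ ≤ C * σ * √((r : ℝ) * max (m : ℝ) (p₂ : ℝ))}
      ≤ ENNReal.ofReal (4 * Real.exp (-c₀ * ((r : ℝ) * max (m : ℝ) (p₂ : ℝ)))) := by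
  refine ⟨1 / 10, by norm_num, fun c hc => ?_⟩
  have hs : 0 < √(5 * c + 4) := Real.sqrt_pos.2 (by linarith)
  -- From `n ≤ cu`, the first radius is at most `σ√(5c + 4)√u`. Each stage multiplies its radius by
  -- `12`: `6` from stability and `2` from the two residuals. Hence `c₂` carries `12` and `C`
  -- carries `144`.
  refine ⟨4 * c + 4, 12 * √(5 * c + 4), by linarith, by linarith,
    144 * √(5 * c + 4), 1, by linarith, one_pos, ?_⟩
  intro p₁ p₂ m n k r hk hr hn Ψ W δΨ δW hδΨ hδW hΨ hW σ hσ
  have hu : 0 ≤ (r : ℝ) * max (m : ℝ) (p₂ : ℝ) := by positivity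
  set u := (r : ℝ) * max (m : ℝ) (p₂ : ℝ) with hu_def
  refine (measure_mono ?_).trans (noiseLaw_feasible hσ hn)
  intro z hz hfeas
  refine hz fun X hXk hXr => ?_
  have hBr : (Ψ * X).rank ≤ r := (Matrix.rank_mul_le_right _ _).trans hXr
  have hBfeas : ‖W (Ψ * X) - (W (Ψ * X) + z)‖ ≤ σ * √((n : ℝ) + (4 * c + 4) * u) := by
    rwa [sub_add_cancel_left, norm_neg]
  refine ⟨lowRankStage_nonempty W hBfeas, fun Bhat hBhat => ?_⟩
  have hrad : √((n : ℝ) + (4 * c + 4) * u) ≤ √(5 * c + 4) * √u := by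
    rw [← Real.sqrt_mul (by linarith)]
    exact Real.sqrt_le_sqrt (by linarith)
  have hstage1 : ‖Bhat - Ψ * X‖ ≤ 12 * √(5 * c + 4) * σ * √u := by
    have hmin : nuclearNorm (Ψ * X + (Bhat - Ψ * X)) ≤ nuclearNorm (Ψ * X) := by
      rw [add_sub_cancel]
      exact hBhat.2 hBfeas
    have h1 := hW.norm_le hδW hr hBr hmin
    have h2 : ‖W (Bhat - Ψ * X)‖ ≤ 2 * (σ * √((n : ℝ) + (4 * c + 4) * u)) := by
      have : W (Bhat - Ψ * X) = (W Bhat - (W (Ψ * X) + z)) + z := by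
        rw [map_sub]
        abel
      rw [this, two_mul]
      exact (norm_add_le _ _).trans (add_le_add hBhat.1 hfeas)
    have h3 := mul_le_mul_of_nonneg_left hrad hσ
    nlinarith
  have hXfeas : ‖Ψ * X - Bhat‖ ≤ 12 * √(5 * c + 4) * σ * √u := by rwa [norm_sub_rev]
  refine ⟨sparseStage_nonempty Ψ hXfeas, fun Xhat hXhat => ?_⟩
  have hmin : rowSumNorm (X + (Xhat - X)) ≤ rowSumNorm X := by
    rw [add_sub_cancel]
    exact hXhat.2 hXfeas
  have h1 := hΨ.norm_le hδΨ hk hXk hmin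
  have h2 : ‖Ψ * (Xhat - X)‖ ≤ 2 * (12 * √(5 * c + 4) * σ * √u) := by
    have : Ψ * (Xhat - X) = (Ψ * Xhat - Bhat) + (Bhat - Ψ * X) := by
      rw [Matrix.mul_sub]
      abel
    rw [this, two_mul]
    exact (norm_add_le _ _).trans (add_le_add hXhat.1 hstage1)
  linarith
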